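/- Let $1\le k\le d-1$, let $P\subset\mathbb R^d$ be a convex polytope (the convex hull of a non-empty finite set), and let $E\subset\mathbb R^d$ be a $k$-dimensional linear subspace. Let $v_k(P,E)$ denote the $k$-dimensional volume of the orthogonal projection $P|E$ of $P$ onto $E$. Let $\mathcal F_k(P)$ be the set of $k$-dimensional faces of $P$ (with $P$ itself counted as a face). For $F\in\mathcal F_k(P)$, let $V_k(F)$ be the $k$-dimensional volume of $F$; let $|\langle E,F\rangle|$ be the absolute value of the determinant of the orthogonal projection from $E$ to the linear subspace parallel to the affine hull of $F$ (with respect to orthonormal bases), and $\langle E,F\rangle^2$ its square; and let $n(P,F)=N(P,F)\cap S^{d-1}$ be the set of unit vectors in the normal cone $N(P,F)=\{u\in\mathbb R^d : \langle u,y-x\rangle\le 0 \text{ for all } x\in F,\ y\in P\}$ of $P$ at $F$. Write $u|E^\perp$ for the orthogonal projection of $u$ onto $E^\perp$, $\mathcal H^{j}$ for the $j$-dimensional Hausdorff measure, normalized to agree with Lebesgue measure on $\mathbb R^j$, and $\omega_n$ for the surface area of the unit ball in $\mathbb R^n$, so that $\omega_n = n\kappa_n$ with $\kappa_n$ the volume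 of that ball. Then $$ v_k(P,E) = \omega_{d-k}^{-1} \sum_{\substack{F\in \mathcal F_k(P)\\ |\langle E,F\rangle|\neq 0}} \langle E,F\rangle^2\, V_k(F)\int_{n(P,F)} \bigl\|u|E^\perp\bigr\|^{k-d}\ \mathcal H^{d-1-k}(du), $$ where each of the finitely many integrals on the right-hand side is finite. -/

import Mathlib

open MeasureTheory
open scoped InnerProductSpace

noncomputable section

/-- A (nonempty) convex polytope in `ℝ^d`: the convex hull of a nonempty finite set of points. -/
def IsConvexPolytope {d : ℕ} (P : Set (EuclideanSpace ℝ (Fin d))) : Prop :=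
  ∃ s : Set (EuclideanSpace ℝ (Fin d)), s.Finite ∧ s.Nonempty ∧ P = convexHull ℝ s

/-- The set of `k`-dimensional faces of `P`. A face is a nonempty set of the form
`{x ∈ P | ∀ y ∈ P, l y ≤ l x}` for a linear functional `l`; the choice `l = 0` gives `P` itself,
so that `P` is a face of `P`. The dimension of a face is that of its affine hull. -/
def kFaces {d : ℕ} (P : Set (EuclideanSpace ℝ (Fin d))) (k : ℕ) :
    Set (Set (EuclideanSpace ℝ (Fin d))) :=
  {F | F.Nonempty ∧ IsExposed ℝ P F ∧ Module.finrank ℝ (vectorSpan ℝ F) = k}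

/-- A polytope has only finitely many `k`-faces. -/
theorem kFaces_finite {d : ℕ} {P : Set (EuclideanSpace ℝ (Fin d))} (hP : IsConvexPolytope P)
    (k : ℕ) : (kFaces P k).Finite := by
  obtain ⟨s, hs, -, rfl⟩ := hP
  have hc : IsCompact (convexHull ℝ s) := hs.isCompact_convexHull ℝ
  refine Set.Finite.of_finite_image (f := fun F => F.extremePoints ℝ)
    (hs.finite_subsets.subset ?_) ?_
  · rintro _ ⟨F, hF, rfl⟩
    exact hF.2.1.isExtreme.extremePoints_subset_extremePoints.trans extremePoints_convexHull_subset
  · intro F hF G hG h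
    have key : ∀ H ∈ kFaces (convexHull ℝ s) k,
        closure (convexHull ℝ (H.extremePoints ℝ)) = H := fun H hH =>
      closure_convexHull_extremePoints (hH.2.1.isCompact hc) (hH.2.1.convex (convex_convexHull ℝ s))
    rw [← key F hF, ← key G hG]
    exact congrArg (fun A => closure (convexHull ℝ A)) h

/-- The normal cone `N(P, F)` of `P` at a face `F`: all vectors `u` that are outer normal vectors
of `P` at every point of `F`. -/
def normalCone {d : ℕ} (P F : Set (EuclideanSpace ℝ (Fin d))) : Set (EuclideanSpace ℝ (Fin d)) :=
  {u | ∀ x ∈ F, ∀ y ∈ P, ⟪u, y - x⟫_ℝ ≤ 0}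

/-- The spherical polytope `n(P, F)`: the unit vectors in the normal cone of `P` at `F`. -/
def unitNormals {d : ℕ} (P F : Set (EuclideanSpace ℝ (Fin d))) : Set (EuclideanSpace ℝ (Fin d)) :=
  normalCone P F ∩ Metric.sphere 0 1

/-- `|⟨A, B⟩|` for two subspaces `A`, `B` of the same dimension: the absolute value of the
determinant of the orthogonal projection `A → B`, with respect to orthonormal bases. -/
def absDet {d : ℕ} (A B : Submodule ℝ (EuclideanSpace ℝ (Fin d))) : ℝ :=
  LinearMap.normDet (B.orthogonalProjectionOnto.toLinearMap ∘ₗ A.subtype)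

/-- The `k`-dimensional volume of a set of dimension at most `k`, as the value of the
`k`-dimensional Hausdorff measure, normalized to agree with Lebesgue measure on `ℝ^k`. For convex
bodies of dimension at most `k` this is the `k`th intrinsic volume. -/
def kVolume {d : ℕ} (k : ℕ) (A : Set (EuclideanSpace ℝ (Fin d))) : ℝ :=
  (μHE[k] A).toReal

/-- The `k`th projection function `v_k(K, E)`, for a `k`-dimensional subspace `E`: the
`k`-dimensional volume of the orthogonal projection of `K` onto `E`. -/
def projectionFunction {d : ℕ} (k : ℕ) (K : Set (EuclideanSpace ℝ (Fin d)))
    (E : Submodule ℝ (EuclideanSpace ℝ (Fin d))) : ℝ :=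
  kVolume k (E.starProjection '' K)

/-- `ω_n = n κ_n`, the surface area of the unit ball of `ℝ^n`, where `κ_n` is its volume. -/
def sphereArea (n : ℕ) : ℝ :=
  n * (volume (Metric.closedBall (0 : EuclideanSpace ℝ (Fin n)) 1)).toReal

end

noncomputable section

open Module Metric Set Filter Topology
open scoped ENNReal NNReal Pointwise

/-! Fix z in Eᗮ. By linear programming duality every point of P|E lifts to a point of P that
maximizes some u with u|Eᗮ = z. Normal cones of faces of dimension above k have dimension below d -
k, so their projections to Eᗮ are null. If z avoids them, the maximizing faces have dimension at
most k, and distinct k-faces arising from the same z have almost disjoint projections. Hence the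
sets F|E with z ∈ N(P,F)|Eᗮ tile P|E up to null sets (`euclideanHausdorffMeasure_image_eq_sum`), and
each has volume |⟨E,F⟩| V_k(F).

Integrate over z in the unit ball of Eᗮ and multiply by d - k. The left side becomes ω_{d-k}
v_k(P,E); on the right appears (d - k) times the volume of N(P,F)|Eᗮ inside the ball. The cone
N(P,F) lies in the (d - k)-dimensional orthogonal complement of the direction space of F, and polar
coordinates there turn this volume into |det T| ∫ ‖Tu‖^{k-d}, with T the projection to Eᗮ
(`normDet_mul_setLIntegral_sphere`). Complementary minors of an orthogonal matrix agree up to sign,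
so |det T| = |⟨E,F⟩| (`normDet_orthogonalProjectionOnto_orthogonal`); this is the second factor in
the square. The integrals are finite because the ball has finite volume.

Polar coordinates use the cone measure on the sphere. It equals Hausdorff measure
(`euclideanHausdorffMeasure_sphere_eq_toSphere`): small caps are compared with their central
projections to a tangent hyperplane, with constants tending to 1. -/

theorem LipschitzOnWith.euclideanHausdorffMeasure_image_le {X Y : Type*} [EMetricSpace X]
    [MeasurableSpace X] [BorelSpace X] [EMetricSpace Y] [MeasurableSpace Y] [BorelSpace Y]
    {K : ℝ≥0} {f : X → Y} {s : Set X} (h : LipschitzOnWith K f s) (m : ℕ) :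
    μHE[m] (f '' s) ≤ (K : ℝ≥0∞) ^ m * μHE[m] s := by
  simp_rw [Measure.euclideanHausdorffMeasure_def, Measure.smul_apply, ENNReal.smul_def,
    smul_eq_mul]
  have := h.hausdorffMeasure_image_le (d := (m : ℝ)) (Nat.cast_nonneg m)
  rw [ENNReal.rpow_natCast] at this
  calc _ ≤ _ := mul_le_mul_right this _
    _ = _ := by ring

/-- Countably many balls of radius r cover X; disjointing them and summing globalizes the local
inequality. -/
theorem MeasureTheory.Measure.le_smul_of_forall_subset_ball {X : Type*} [PseudoMetricSpace X]
    [SecondCountableTopology X] [MeasurableSpace X] [OpensMeasurableSpace X] {μ ν : Measure X}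
    {C : ℝ≥0∞} {r : ℝ} (hr : 0 < r)
    (h : ∀ x, ∀ A ⊆ ball x r, MeasurableSet A → μ A ≤ C * ν A) {A : Set X}
    (hA : MeasurableSet A) : μ A ≤ C * ν A := by
  rcases isEmpty_or_nonempty X with hX | hX
  · simp [Set.eq_empty_of_isEmpty A]
  let B : ℕ → Set X := fun i => ball (TopologicalSpace.denseSeq X i) r
  have hB : ⋃ i, disjointed B i = univ := by
    rw [iUnion_disjointed, eq_univ_iff_forall]
    intro x
    obtain ⟨i, hi⟩ := (TopologicalSpace.denseRange_denseSeq X).exists_dist_lt x hr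
    exact mem_iUnion.2 ⟨i, hi⟩
  have hm : ∀ i, MeasurableSet (A ∩ disjointed B i) := fun i =>
    hA.inter (MeasurableSet.disjointed (fun i => measurableSet_ball) i)
  have hd : Pairwise (Function.onFun Disjoint fun i => A ∩ disjointed B i) := fun i j hij =>
    (disjoint_disjointed B hij).mono inter_subset_right inter_subset_right
  have hU : A = ⋃ i, A ∩ disjointed B i := by rw [← inter_iUnion, hB, inter_univ]
  rw [hU, measure_iUnion hd hm, measure_iUnion hd hm, ← ENNReal.tsum_mul_left]
  exact ENNReal.tsum_le_tsum fun i =>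
    h _ _ (inter_subset_right.trans (disjointed_subset B i)) (hm i)

/-! ### Central projection to a tangent hyperplane, and volumes of cones. -/

section Sphere

variable {V : Type*} [NormedAddCommGroup V] [InnerProductSpace ℝ V]

/-- With c the cosine of the angle, the squares differ by (‖x‖ - ‖y‖)² + 2(‖x‖‖y‖ - 1)(1 - c) ≥ 0.
-/
theorem dist_normalize_le {x y : V} (hx : 1 ≤ ‖x‖) (hy : 1 ≤ ‖y‖) :
    ‖‖x‖⁻¹ • x - ‖y‖⁻¹ • y‖ ≤ ‖x - y‖ := by
  have hx0 : 0 < ‖x‖ := by linarith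
  have hy0 : 0 < ‖y‖ := by linarith
  refine le_of_sq_le_sq ?_ (norm_nonneg _)
  rw [norm_sub_sq_real, norm_sub_sq_real, norm_smul, norm_smul, inner_smul_left, inner_smul_right]
  simp only [norm_inv, norm_norm, inv_mul_cancel₀ hx0.ne', inv_mul_cancel₀ hy0.ne', conj_trivial]
  set c := ‖x‖⁻¹ * (‖y‖⁻¹ * ⟪x, y⟫_ℝ) with hc
  have hxy : ⟪x, y⟫_ℝ = ‖x‖ * ‖y‖ * c := by rw [hc]; field_simp
  have hc1 : c ≤ 1 := by
    have := real_inner_le_norm x y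
    rw [hxy] at this
    exact le_of_mul_le_mul_left (by linarith) (mul_pos hx0 hy0)
  rw [hxy]
  have h1 : 1 ≤ ‖x‖ * ‖y‖ := one_le_mul_of_one_le_of_one_le hx hy
  nlinarith [sq_nonneg (‖x‖ - ‖y‖), mul_nonneg (sub_nonneg.2 h1) (sub_nonneg.2 hc1)]

/-- For unit vectors, a + b is orthogonal to b - a, so p may be replaced by its difference from the
midpoint. The small factor δ is what makes the Lipschitz constant of the tangent projection tend to
1. -/
theorem abs_inner_sub_le_of_norm_eq_one {p a b : V} {δ : ℝ} (ha : ‖a‖ = 1) (hb : ‖b‖ = 1)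
    (hap : ‖a - p‖ ≤ δ) (hbp : ‖b - p‖ ≤ δ) : |⟪p, b - a⟫_ℝ| ≤ δ * ‖a - b‖ := by
  have h0 : ⟪a + b, b - a⟫_ℝ = 0 := by
    rw [inner_add_left, inner_sub_right, inner_sub_right, real_inner_self_eq_norm_sq,
      real_inner_self_eq_norm_sq, ha, hb, real_inner_comm]
    ring
  have h1 : ⟪p, b - a⟫_ℝ = ⟪p - (2⁻¹ : ℝ) • (a + b), b - a⟫_ℝ := by
    rw [inner_sub_left, inner_smul_left, h0]; simp
  have h2 : ‖p - (2⁻¹ : ℝ) • (a + b)‖ ≤ δ := by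
    have : p - (2⁻¹ : ℝ) • (a + b) = (2⁻¹ : ℝ) • ((p - a) + (p - b)) := by
      module
    rw [this, norm_smul]
    have h3 := norm_add_le (p - a) (p - b)
    rw [norm_sub_rev p a, norm_sub_rev p b] at h3
    norm_num
    linarith
  rw [h1, norm_sub_rev a b]
  exact (abs_real_inner_le_norm _ _).trans (mul_le_mul_of_nonneg_right h2 (norm_nonneg _))

/-- The central projection onto the affine tangent hyperplane of the unit sphere at `p`. -/
def tangentProjection (p a : V) : V := (⟪p, a⟫_ℝ)⁻¹ • a

theorem inner_tangentProjection {p a : V} (h : 0 < ⟪p, a⟫_ℝ) :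
    ⟪p, tangentProjection p a⟫_ℝ = 1 := by
  simp [tangentProjection, inner_smul_right, h.ne']

theorem one_sub_le_inner_of_norm_sub_le {p a : V} {δ : ℝ} (hp : ‖p‖ = 1)
    (hap : ‖a - p‖ ≤ δ) : 1 - δ ≤ ⟪p, a⟫_ℝ := by
  have h1 : ⟪p, a⟫_ℝ = 1 + ⟪p, a - p⟫_ℝ := by
    rw [inner_sub_right, real_inner_self_eq_norm_sq, hp]; ring
  have h2 := abs_real_inner_le_norm p (a - p)
  rw [hp, one_mul] at h2
  linarith [neg_abs_le ⟪p, a - p⟫_ℝ]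

theorem norm_tangentProjection_sub_le {p a b : V} {δ : ℝ} (hδ : δ < 1) (hp : ‖p‖ = 1)
    (ha : ‖a‖ = 1) (hb : ‖b‖ = 1) (hap : ‖a - p‖ ≤ δ) (hbp : ‖b - p‖ ≤ δ) :
    ‖tangentProjection p a - tangentProjection p b‖ ≤
      ((1 - δ)⁻¹ + δ * ((1 - δ)⁻¹ * (1 - δ)⁻¹)) * ‖a - b‖ := by
  have hs := one_sub_le_inner_of_norm_sub_le hp hap
  have hr := one_sub_le_inner_of_norm_sub_le hp hbp
  have hi := abs_inner_sub_le_of_norm_eq_one ha hb hap hbp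
  have hc : 0 < 1 - δ := by linarith
  have hδ0 : 0 ≤ δ := (norm_nonneg _).trans hap
  rw [inner_sub_right] at hi
  unfold tangentProjection
  set s := ⟪p, a⟫_ℝ
  set r := ⟪p, b⟫_ℝ
  have hs0 : 0 < s := by linarith
  have hr0 : 0 < r := by linarith
  have e : s⁻¹ • a - r⁻¹ • b = s⁻¹ • (a - b) + ((r - s) * (s⁻¹ * r⁻¹)) • b := by
    have : (r - s) * (s⁻¹ * r⁻¹) = s⁻¹ - r⁻¹ := by field_simp
    rw [this]; module
  have hs1 : s⁻¹ ≤ (1 - δ)⁻¹ := inv_anti₀ hc hs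
  have hr1 : r⁻¹ ≤ (1 - δ)⁻¹ := inv_anti₀ hc hr
  have hs2 : 0 ≤ s⁻¹ := by positivity
  have hr2 : 0 ≤ r⁻¹ := by positivity
  have hc2 : 0 ≤ (1 - δ)⁻¹ := by positivity
  rw [e]
  refine (norm_add_le _ _).trans ?_
  rw [norm_smul, norm_smul, hb, mul_one, norm_mul, Real.norm_eq_abs s⁻¹, abs_of_nonneg hs2,
    Real.norm_eq_abs (s⁻¹ * r⁻¹), abs_of_nonneg (mul_nonneg hs2 hr2), Real.norm_eq_abs, add_mul]
  have h3 : s⁻¹ * r⁻¹ ≤ (1 - δ)⁻¹ * (1 - δ)⁻¹ := mul_le_mul hs1 hr1 hr2 hc2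
  have h4 : |r - s| * (s⁻¹ * r⁻¹) ≤ δ * ‖a - b‖ * ((1 - δ)⁻¹ * (1 - δ)⁻¹) :=
    mul_le_mul hi h3 (mul_nonneg hs2 hr2) (by positivity)
  have h5 := mul_le_mul_of_nonneg_right hs1 (norm_nonneg (a - b))
  linarith

variable [FiniteDimensional ℝ V] [MeasurableSpace V] [BorelSpace V]

theorem measurableSet_Ioo_smul_of_subset_hyperplane {p : V} {A : Set V} (hA : MeasurableSet A)
    (hAp : ∀ a ∈ A, ⟪p, a⟫_ℝ = 1) : MeasurableSet (Ioo (0 : ℝ) 1 • A) := by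
  have : Ioo (0 : ℝ) 1 • A =
      (fun x => ⟪p, x⟫_ℝ) ⁻¹' Ioo 0 1 ∩ (fun x => (⟪p, x⟫_ℝ)⁻¹ • x) ⁻¹' A := by
    ext x
    constructor
    · rintro ⟨t, ht, a, ha, rfl⟩
      simp only [mem_inter_iff, mem_preimage, inner_smul_right, hAp a ha, mul_one]
      refine ⟨ht, ?_⟩
      rwa [smul_smul, inv_mul_cancel₀ ht.1.ne', one_smul]
    · rintro ⟨h1, h2⟩
      exact ⟨_, h1, _, h2, by simp [smul_smul, mul_inv_cancel₀ (ne_of_gt h1.1)]⟩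
  rw [this]
  have h1 : Measurable fun x : V => ⟪p, x⟫_ℝ := by fun_prop
  exact (h1 measurableSet_Ioo).inter ((h1.inv.smul measurable_id) hA)

/-- The volume of a cone with apex `0` over a base in a hyperplane at distance `1`. -/
theorem volume_Ioo_smul_of_subset_hyperplane {p : V} (hp : ‖p‖ = 1) {A : Set V}
    (hA : MeasurableSet A) (hAp : ∀ a ∈ A, ⟪p, a⟫_ℝ = 1) :
    finrank ℝ V * volume (Ioo (0 : ℝ) 1 • A) = μHE[finrank ℝ V - 1] A := by
  have hp0 : p ≠ 0 := by rintro rfl; simp at hp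
  have : Nontrivial V := ⟨⟨p, 0, hp0⟩⟩
  have hn : 0 < finrank ℝ V := finrank_pos
  have hC := measurableSet_Ioo_smul_of_subset_hyperplane hA hAp
  rw [← InnerProductSpace.euclideanHausdorffMeasure_eq_volume,
    EuclideanGeometry.euclideanHausdorffMeasure_eq_lintegral (0 : V) hp0 hC]
  -- The slice at height x is x • A for 0 < x < 1 and empty otherwise; integrating x^(n-1) then
  -- gives 1/n.
  have hslice : ∀ x : ℝ, μHE[finrank ℝ V - 1]
      (Ioo (0 : ℝ) 1 • A ∩ AffineSubspace.mk' (x • p +ᵥ (0 : V)) (ℝ ∙ p)ᗮ) =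
      (Ioo (0 : ℝ) 1).indicator
        (fun x => ENNReal.ofReal (x ^ (finrank ℝ V - 1)) * μHE[finrank ℝ V - 1] A) x := by
    intro x
    have hmem : ∀ y : V, y ∈ AffineSubspace.mk' (x • p +ᵥ (0 : V)) (ℝ ∙ p)ᗮ ↔ ⟪p, y⟫_ℝ = x := by
      intro y
      rw [AffineSubspace.mem_mk', Submodule.mem_orthogonal_singleton_iff_inner_right]
      simp [inner_sub_right, inner_smul_right, hp, sub_eq_zero]
    by_cases hx : x ∈ Ioo (0 : ℝ) 1
    · rw [indicator_of_mem hx]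
      have : Ioo (0 : ℝ) 1 • A ∩ AffineSubspace.mk' (x • p +ᵥ (0 : V)) (ℝ ∙ p)ᗮ = x • A := by
        ext y
        simp only [mem_inter_iff, SetLike.mem_coe, hmem]
        constructor
        · rintro ⟨⟨t, ht, a, ha, rfl⟩, h⟩
          simp only [inner_smul_right, hAp a ha, mul_one] at h
          subst h
          exact ⟨a, ha, rfl⟩
        · rintro ⟨a, ha, rfl⟩
          exact ⟨⟨x, hx, a, ha, rfl⟩, by simp [inner_smul_right, hAp a ha]⟩
      rw [this, Measure.euclideanHausdorffMeasure_smul₀ _ hx.1.ne', ENNReal.smul_def, smul_eq_mul,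
        ENNReal.ofReal_pow hx.1.le, ENNReal.coe_pow, ← enorm_eq_nnnorm,
        Real.enorm_eq_ofReal hx.1.le]
    · rw [indicator_of_notMem hx]
      have : Ioo (0 : ℝ) 1 • A ∩ AffineSubspace.mk' (x • p +ᵥ (0 : V)) (ℝ ∙ p)ᗮ = ∅ := by
        rw [eq_empty_iff_forall_notMem]
        rintro y ⟨⟨t, ht, a, ha, rfl⟩, h⟩
        rw [SetLike.mem_coe, hmem] at h
        simp only [inner_smul_right, hAp a ha, mul_one] at h
        exact hx (h ▸ ht)
      rw [this, measure_empty]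
  simp_rw [hslice]
  rw [lintegral_indicator measurableSet_Ioo, lintegral_mul_const _ (by fun_prop),
    ← ofReal_integral_eq_lintegral_ofReal]
  · rw [← integral_Ioc_eq_integral_Ioo, ← intervalIntegral.integral_of_le zero_le_one,
      integral_pow]
    have : ((finrank ℝ V - 1 : ℕ) : ℝ) + 1 = finrank ℝ V := by
      rw [Nat.cast_sub hn]; simp
    rw [this, Nat.sub_add_cancel hn, ← enorm_norm p, hp]
    simp only [one_pow, zero_pow hn.ne', sub_zero, enorm_one, one_mul]
    rw [← mul_assoc, ← ENNReal.ofReal_natCast, ← ENNReal.ofReal_mul (by positivity)]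
    rw [mul_one_div_cancel (by positivity)]
    simp
  · exact (continuous_pow _).integrableOn_Icc.mono_set Ioo_subset_Icc_self
  · filter_upwards [ae_restrict_mem measurableSet_Ioo] with x hx
    exact pow_nonneg hx.1.le _

end Sphere

/-! ### Hausdorff measure and cone measure on the unit sphere. -/

section Sphere

variable {V : Type*} [NormedAddCommGroup V] [InnerProductSpace ℝ V]
variable [FiniteDimensional ℝ V] [MeasurableSpace V] [BorelSpace V]

theorem measurableSet_tangentProjection_image {p : V} {A : Set V} {δ : ℝ} (hδ : δ < 1)
    (hp : ‖p‖ = 1) (hA : MeasurableSet A) (hA1 : ∀ a ∈ A, ‖a‖ = 1)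
    (hAp : ∀ a ∈ A, ‖a - p‖ ≤ δ) : MeasurableSet (tangentProjection p '' A) := by
  have : tangentProjection p '' A = {x | ⟪p, x⟫_ℝ = 1} ∩ (fun x => ‖x‖⁻¹ • x) ⁻¹' A := by
    ext x
    constructor
    · rintro ⟨a, ha, rfl⟩
      have hs := one_sub_le_inner_of_norm_sub_le hp (hAp a ha)
      have hs0 : 0 < ⟪p, a⟫_ℝ := by linarith
      constructor
      · simp [tangentProjection, inner_smul_right, hs0.ne']
      · simp only [mem_preimage, tangentProjection, norm_smul, hA1 a ha, norm_inv, mul_one, inv_inv,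
          Real.norm_eq_abs, abs_of_pos hs0, smul_smul, mul_inv_cancel₀ hs0.ne', one_smul]
        exact ha
    · rintro ⟨h1, h2⟩
      have hx : x ≠ 0 := by rintro rfl; simp at h1
      have hx' : ‖x‖ ≠ 0 := norm_ne_zero_iff.2 hx
      refine ⟨_, h2, ?_⟩
      rw [tangentProjection, inner_smul_right, show ⟪p, x⟫_ℝ = 1 from h1, smul_smul]
      simp [hx']
  rw [this]
  refine MeasurableSet.inter ?_ ?_
  · exact (isClosed_eq (by fun_prop) continuous_const).measurableSet
  · exact (measurable_norm.inv.smul measurable_id) hA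

/-- Normalization maps the tangent image of A back to A and is 1-Lipschitz; the cone over that image
lies in (1 - δ)⁻¹ times the cone over A. -/
theorem euclideanHausdorffMeasure_le_mul_volume_Ioo_smul {p : V} {A : Set V} {δ : ℝ} (hδ : δ < 1)
    (hp : ‖p‖ = 1) (hA : MeasurableSet A) (hA1 : ∀ a ∈ A, ‖a‖ = 1)
    (hAp : ∀ a ∈ A, ‖a - p‖ ≤ δ) :
    μHE[finrank ℝ V - 1] A ≤
      ENNReal.ofReal ((1 - δ)⁻¹ ^ finrank ℝ V) *
        (finrank ℝ V * volume (Ioo (0 : ℝ) 1 • A)) := by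
  have hs : ∀ a ∈ A, 1 - δ ≤ ⟪p, a⟫_ℝ := fun a ha =>
    one_sub_le_inner_of_norm_sub_le hp (hAp a ha)
  have hc : 0 < 1 - δ := by linarith
  have hs0 : ∀ a ∈ A, 0 < ⟪p, a⟫_ℝ := fun a ha => hc.trans_le (hs a ha)
  have hB := measurableSet_tangentProjection_image hδ hp hA hA1 hAp
  have hBp : ∀ b ∈ tangentProjection p '' A, ⟪p, b⟫_ℝ = 1 := by
    rintro _ ⟨a, ha, rfl⟩
    exact inner_tangentProjection (hs0 a ha)
  have hBn : ∀ b ∈ tangentProjection p '' A, 1 ≤ ‖b‖ := by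
    intro b hb
    have := real_inner_le_norm p b
    rwa [hBp b hb, hp, one_mul] at this
  have hL : LipschitzOnWith 1 (fun x : V => ‖x‖⁻¹ • x) (tangentProjection p '' A) :=
    LipschitzOnWith.of_dist_le_mul fun x hx y hy => by
      simpa [dist_eq_norm] using dist_normalize_le (hBn x hx) (hBn y hy)
  have him : (fun x : V => ‖x‖⁻¹ • x) '' (tangentProjection p '' A) = A := by
    rw [image_image]
    conv_rhs => rw [← image_id A]
    refine image_congr fun a ha => ?_
    have := hs0 a ha
    simp only [tangentProjection, norm_smul, hA1 a ha, norm_inv, mul_one, inv_inv,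
          Real.norm_eq_abs, abs_of_pos this, smul_smul, mul_inv_cancel₀ this.ne', one_smul, id]
  have h1 := hL.euclideanHausdorffMeasure_image_le (finrank ℝ V - 1)
  rw [him, ENNReal.coe_one, one_pow, one_mul, ← volume_Ioo_smul_of_subset_hyperplane hp hB hBp]
    at h1
  refine h1.trans ?_
  have hsub : Ioo (0 : ℝ) 1 • (tangentProjection p '' A) ⊆ (1 - δ)⁻¹ • (Ioo (0 : ℝ) 1 • A) := by
    rintro _ ⟨t, ht, _, ⟨a, ha, rfl⟩, rfl⟩
    have h0 := hs0 a ha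
    refine ⟨(t * ((1 - δ) * (⟪p, a⟫_ℝ)⁻¹)) • a, ⟨_, ⟨?_, ?_⟩, a, ha, rfl⟩, ?_⟩
    · have := ht.1
      positivity
    · have : (1 - δ) * (⟪p, a⟫_ℝ)⁻¹ ≤ 1 := by
        rw [← div_eq_mul_inv]; exact div_le_one_of_le₀ (hs a ha) h0.le
      have h2 : 0 ≤ (1 - δ) * (⟪p, a⟫_ℝ)⁻¹ := by positivity
      calc _ ≤ t * 1 := mul_le_mul_of_nonneg_left this ht.1.le
        _ < 1 := by linarith [ht.2]
    · simp only [tangentProjection, smul_smul]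
      congr 1
      field_simp
  calc _ ≤ finrank ℝ V * volume ((1 - δ)⁻¹ • (Ioo (0 : ℝ) 1 • A)) := by gcongr
    _ = _ := by
      rw [Measure.addHaar_smul_of_nonneg _ (by positivity)]
      ring

/-- Since ⟪p, a⟫ ≤ 1, the cone over A lies in the cone over its tangent image, whose base is
controlled by the Lipschitz bound. -/
theorem mul_volume_Ioo_smul_le_euclideanHausdorffMeasure {p : V} {A : Set V} {δ : ℝ} (hδ0 : 0 ≤ δ)
    (hδ : δ < 1) (hp : ‖p‖ = 1) (hA : MeasurableSet A) (hA1 : ∀ a ∈ A, ‖a‖ = 1)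
    (hAp : ∀ a ∈ A, ‖a - p‖ ≤ δ) :
    finrank ℝ V * volume (Ioo (0 : ℝ) 1 • A) ≤
      ENNReal.ofReal (((1 - δ)⁻¹ + δ * ((1 - δ)⁻¹ * (1 - δ)⁻¹)) ^ (finrank ℝ V - 1)) *
        μHE[finrank ℝ V - 1] A := by
  have hs : ∀ a ∈ A, 1 - δ ≤ ⟪p, a⟫_ℝ := fun a ha =>
    one_sub_le_inner_of_norm_sub_le hp (hAp a ha)
  have hc : 0 < 1 - δ := by linarith
  have hs0 : ∀ a ∈ A, 0 < ⟪p, a⟫_ℝ := fun a ha => hc.trans_le (hs a ha)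
  have hB := measurableSet_tangentProjection_image hδ hp hA hA1 hAp
  have hBp : ∀ b ∈ tangentProjection p '' A, ⟪p, b⟫_ℝ = 1 := by
    rintro _ ⟨a, ha, rfl⟩
    exact inner_tangentProjection (hs0 a ha)
  have hK : 0 ≤ (1 - δ)⁻¹ + δ * ((1 - δ)⁻¹ * (1 - δ)⁻¹) := by positivity
  have hL : LipschitzOnWith (Real.toNNReal ((1 - δ)⁻¹ + δ * ((1 - δ)⁻¹ * (1 - δ)⁻¹)))
      (tangentProjection p) A :=
    LipschitzOnWith.of_dist_le_mul fun x hx y hy => by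
      rw [dist_eq_norm, dist_eq_norm, Real.coe_toNNReal _ hK]
      exact norm_tangentProjection_sub_le hδ hp (hA1 x hx) (hA1 y hy) (hAp x hx) (hAp y hy)
  have h1 := hL.euclideanHausdorffMeasure_image_le (finrank ℝ V - 1)
  rw [← volume_Ioo_smul_of_subset_hyperplane hp hB hBp] at h1
  have hsub : Ioo (0 : ℝ) 1 • A ⊆ Ioo (0 : ℝ) 1 • (tangentProjection p '' A) := by
    rintro _ ⟨t, ht, a, ha, rfl⟩
    have h0 := hs0 a ha
    have h2 : ⟪p, a⟫_ℝ ≤ 1 := by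
      have := real_inner_le_norm p a
      rwa [hp, hA1 a ha, one_mul] at this
    refine ⟨t * ⟪p, a⟫_ℝ, ⟨mul_pos ht.1 h0, ?_⟩, _, ⟨a, ha, rfl⟩, ?_⟩
    · calc _ ≤ t * 1 := mul_le_mul_of_nonneg_left h2 ht.1.le
        _ < 1 := by linarith [ht.2]
    · simp only [tangentProjection, smul_smul]
      congr 1
      field_simp
  rw [ENNReal.ofReal_pow hK]
  calc _ ≤ finrank ℝ V * volume (Ioo (0 : ℝ) 1 • (tangentProjection p '' A)) := by gcongr
    _ ≤ _ := h1

/-- On the unit sphere of a Euclidean space, the Hausdorff measure of codimension one is the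
spherical measure from polar coordinates. -/
theorem euclideanHausdorffMeasure_sphere_eq_toSphere :
    (μHE[finrank ℝ V - 1] : Measure (sphere (0 : V) 1)) = (volume : Measure V).toSphere := by
  have himg : ∀ A : Set (sphere (0 : V) 1),
      μHE[finrank ℝ V - 1] ((↑) '' A : Set V) = μHE[finrank ℝ V - 1] A := fun A =>
    isometry_subtype_coe.euclideanHausdorffMeasure_image A
  have hmeas : ∀ {A : Set (sphere (0 : V) 1)}, MeasurableSet A →
      MeasurableSet ((↑) '' A : Set V) := fun hA =>
    (MeasurableEmbedding.subtype_coe isClosed_sphere.measurableSet).measurableSet_image.2 hA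
  have hnorm : ∀ A : Set (sphere (0 : V) 1), ∀ a ∈ ((↑) '' A : Set V), ‖a‖ = 1 := by
    rintro A _ ⟨a, -, rfl⟩
    exact norm_eq_of_mem_sphere a
  have hsub : ∀ {δ : ℝ} {A : Set (sphere (0 : V) 1)} {p : sphere (0 : V) 1}, A ⊆ ball p δ →
      ∀ a ∈ ((↑) '' A : Set V), ‖a - p‖ ≤ δ := by
    rintro δ A p hA _ ⟨a, ha, rfl⟩
    have := hA ha
    rw [mem_ball, Subtype.dist_eq, dist_eq_norm] at this
    exact this.le
  have hle : ∀ δ ∈ Ioo (0 : ℝ) 1, ∀ A : Set (sphere (0 : V) 1), MeasurableSet A →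
      μHE[finrank ℝ V - 1] A ≤
        ENNReal.ofReal ((1 - δ)⁻¹ ^ finrank ℝ V) * (volume : Measure V).toSphere A := by
    intro δ hδ A hA
    refine Measure.le_smul_of_forall_subset_ball hδ.1 (fun p A hAp hA => ?_) hA
    rw [Measure.toSphere_apply' _ hA, ← himg]
    exact euclideanHausdorffMeasure_le_mul_volume_Ioo_smul hδ.2 (norm_eq_of_mem_sphere p)
      (hmeas hA) (hnorm A) (hsub hAp)
  have hge : ∀ δ ∈ Ioo (0 : ℝ) 1, ∀ A : Set (sphere (0 : V) 1), MeasurableSet A →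
      (volume : Measure V).toSphere A ≤
        ENNReal.ofReal (((1 - δ)⁻¹ + δ * ((1 - δ)⁻¹ * (1 - δ)⁻¹)) ^ (finrank ℝ V - 1)) *
          μHE[finrank ℝ V - 1] A := by
    intro δ hδ A hA
    refine Measure.le_smul_of_forall_subset_ball hδ.1 (fun p A hAp hA => ?_) hA
    rw [Measure.toSphere_apply' _ hA, ← himg]
    exact mul_volume_Ioo_smul_le_euclideanHausdorffMeasure hδ.1.le hδ.2 (norm_eq_of_mem_sphere p)
      (hmeas hA) (hnorm A) (hsub hAp)
  have hev : ∀ᶠ δ : ℝ in 𝓝[>] 0, δ ∈ Ioo (0 : ℝ) 1 := Ioo_mem_nhdsGT one_pos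
  -- Letting δ → 0 removes the constant. Finiteness is known first for the cone measure, and passes
  -- to Hausdorff measure through `h1`.
  have key : ∀ (g : ℝ → ℝ), ContinuousAt g 0 → g 0 = 1 → ∀ x y : ℝ≥0∞, x ≠ ∞ →
      (∀ δ ∈ Ioo (0 : ℝ) 1, y ≤ ENNReal.ofReal (g δ) * x) → y ≤ x := by
    intro g hg hg0 x y hx h
    have ht : Tendsto (fun δ => ENNReal.ofReal (g δ) * x) (𝓝[>] 0) (𝓝 (ENNReal.ofReal 1 * x)) := by
      refine ENNReal.Tendsto.mul_const (ENNReal.tendsto_ofReal ?_) (Or.inr hx)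
      rw [← hg0]
      exact hg.tendsto.mono_left nhdsWithin_le_nhds
    rw [ENNReal.ofReal_one, one_mul] at ht
    exact ge_of_tendsto ht (hev.mono h)
  ext A hA
  have hfin : (volume : Measure V).toSphere A ≠ ∞ := measure_ne_top _ _
  have h1 : μHE[finrank ℝ V - 1] A ≤ (volume : Measure V).toSphere A := by
    refine key (fun δ => (1 - δ)⁻¹ ^ finrank ℝ V) ?_ (by simp) _ _ hfin fun δ hδ => hle δ hδ A hA
    have : (1 - (0 : ℝ)) ≠ 0 := by norm_num
    fun_prop (disch := assumption)
  refine le_antisymm h1 ?_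
  refine key (fun δ => ((1 - δ)⁻¹ + δ * ((1 - δ)⁻¹ * (1 - δ)⁻¹)) ^ (finrank ℝ V - 1)) ?_ (by simp)
    _ _ (h1.trans_lt hfin.lt_top).ne fun δ hδ => hge δ hδ A hA
  have : (1 - (0 : ℝ)) ≠ 0 := by norm_num
  fun_prop (disch := assumption)

end Sphere

/-! ### Polar coordinates on cones. -/

section Polar

variable {V W : Type*} [NormedAddCommGroup V] [InnerProductSpace ℝ V]
  [MeasurableSpace V] [BorelSpace V] [NormedAddCommGroup W] [InnerProductSpace ℝ W]

theorem setLIntegral_sphere_inter_submodule (L : Submodule ℝ V) (m : ℕ) {N : Set V}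
    (hNL : N ⊆ L) (hN : MeasurableSet N) {f : V → ℝ≥0∞} (hf : Measurable f) :
    ∫⁻ u in N ∩ sphere 0 1, f u ∂μHE[m] =
      ∫⁻ u in ((↑) ⁻¹' ((↑) ⁻¹' N : Set L) : Set (sphere (0 : L) 1)), f u ∂μHE[m] := by
  have hι : Isometry (fun u : sphere (0 : L) 1 => ((u : L) : V)) :=
    L.subtypeₗᵢ.isometry.comp isometry_subtype_coe
  have hms : Measurable (fun u : sphere (0 : L) 1 => ((u : L) : V)) := hι.continuous.measurable
  have hr : range (fun u : sphere (0 : L) 1 => ((u : L) : V)) = (L : Set V) ∩ sphere 0 1 := by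
    ext x
    constructor
    · rintro ⟨u, rfl⟩
      exact ⟨(u : L).2, mem_sphere_zero_iff_norm.2 (norm_eq_of_mem_sphere u)⟩
    · rintro ⟨h1, h2⟩
      exact ⟨⟨⟨x, h1⟩, by simpa using h2⟩, rfl⟩
  have hres : (μHE[m] : Measure V).restrict (N ∩ sphere 0 1) =
      (((μHE[m] : Measure (sphere (0 : L) 1)).map
        fun u : sphere (0 : L) 1 => ((u : L) : V))).restrict N := by
    rw [hι.map_euclideanHausdorffMeasure, Measure.restrict_restrict hN, hr, ← inter_assoc,
      inter_eq_left.2 hNL]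
  rw [hres, setLIntegral_map hN hf hms]
  rfl

variable [FiniteDimensional ℝ V]

/-- On the ray through a unit vector u of the cone, ‖T(ru)‖ < 1 means r < ‖Tu‖⁻¹, and n ∫ r^(n-1) dr
over that range is ‖Tu‖⁻ⁿ. -/
theorem setLIntegral_toSphere_inv_norm_pow [Nontrivial V] (T : V →ₗ[ℝ] W)
    (hT : Function.Injective T) {N : Set V} (hN : MeasurableSet N)
    (hcone : ∀ u : V, ∀ t : ℝ, 0 < t → (t • u ∈ N ↔ u ∈ N)) :
    ∫⁻ u in ((↑) ⁻¹' N : Set (sphere (0 : V) 1)),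
        ENNReal.ofReal ((‖T u‖ ^ finrank ℝ V)⁻¹) ∂(volume : Measure V).toSphere =
      finrank ℝ V * volume {u ∈ N | ‖T u‖ < 1} := by
  have hn : 0 < finrank ℝ V := finrank_pos
  have hTc : Continuous T := T.continuous_of_finiteDimensional
  let R : Set (sphere (0 : V) 1 × Ioi (0 : ℝ)) := {q | (q.1 : V) ∈ N ∧ (q.2 : ℝ) * ‖T q.1‖ < 1}
  have hNS : MeasurableSet ((↑) ⁻¹' N : Set (sphere (0 : V) 1)) := measurable_subtype_coe hN
  have hR : MeasurableSet R := by
    refine MeasurableSet.inter (measurable_fst hNS) ?_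
    refine (isOpen_lt (f := fun q : sphere (0 : V) 1 × Ioi (0 : ℝ) => (q.2 : ℝ) * ‖T q.1‖) ?_
      continuous_const).measurableSet
    fun_prop
  have hpre : homeomorphUnitSphereProd V ⁻¹' R =
      ((↑) ⁻¹' {u ∈ N | ‖T u‖ < 1} : Set ({0}ᶜ : Set V)) := by
    ext ⟨x, hx⟩
    have hx0 : 0 < ‖x‖ := norm_pos_iff.2 hx
    simp only [mem_preimage, R, mem_ofPred_eq, homeomorphUnitSphereProd_apply_fst_coe,
      homeomorphUnitSphereProd_apply_snd_coe, hcone x _ (inv_pos.2 hx0), map_smul, norm_smul,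
      norm_inv, norm_norm, mul_inv_cancel_left₀ hx0.ne']
  have h1 := ((volume : Measure V).measurePreserving_homeomorphUnitSphereProd).measure_preimage
    hR.nullMeasurableSet
  have hsub : (↑) '' ((↑) ⁻¹' {u ∈ N | ‖T u‖ < 1} : Set ({0}ᶜ : Set V)) =
      {u ∈ N | ‖T u‖ < 1} \ {0} := by
    rw [Subtype.image_preimage_coe, Set.sdiff_eq, inter_comm]
  rw [hpre, comap_subtype_coe_apply (measurableSet_singleton _).compl, hsub,
    measure_sdiff_null (measure_singleton _), Measure.prod_apply hR] at h1
  rw [h1, ← lintegral_const_mul _ (measurable_measure_prodMk_left hR),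
    ← lintegral_indicator hNS]
  refine lintegral_congr fun u => ?_
  by_cases hu : (u : V) ∈ N
  · rw [indicator_of_mem (show u ∈ ((↑) ⁻¹' N : Set (sphere (0 : V) 1)) from hu)]
    have hu0 : 0 < ‖T u‖ := norm_pos_iff.2 fun h =>
      ne_zero_of_mem_unit_sphere u (hT (h.trans (map_zero T).symm))
    have : Prod.mk u ⁻¹' R = Iio (⟨‖T u‖⁻¹, inv_pos.2 hu0⟩ : Ioi (0 : ℝ)) := by
      ext r
      rw [mem_Iio, ← Subtype.coe_lt_coe]
      change ((u : V) ∈ N ∧ (r : ℝ) * ‖T u‖ < 1) ↔ (r : ℝ) < ‖T u‖⁻¹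
      rw [← one_div, lt_div_iff₀ hu0]
      exact and_iff_right hu
    rw [this, Measure.volumeIoiPow_apply_Iio, ← ENNReal.ofReal_natCast,
      ← ENNReal.ofReal_mul (by positivity)]
    have h2 : ((finrank ℝ V - 1 : ℕ) : ℝ) + 1 = finrank ℝ V := by
      rw [Nat.cast_sub hn]; simp
    rw [h2, Nat.sub_add_cancel hn, mul_div_cancel₀ _ (by positivity), inv_pow]
  · rw [indicator_of_notMem (show u ∉ ((↑) ⁻¹' N : Set (sphere (0 : V) 1)) from hu)]
    have : Prod.mk u ⁻¹' R = ∅ := by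
      rw [eq_empty_iff_forall_notMem]
      rintro r ⟨h, -⟩
      exact hu h
    rw [this, measure_empty, mul_zero]

variable [MeasurableSpace W] [BorelSpace W]

theorem normDet_mul_setLIntegral_sphere (L : Submodule ℝ V) (hL : 0 < finrank ℝ L)
    (T : V →ₗ[ℝ] W) (hT : (T.domRestrict L).normDet ≠ 0) {N : Set V} (hN : MeasurableSet N)
    (hNL : N ⊆ L) (hcone : ∀ u : V, ∀ t : ℝ, 0 < t → (t • u ∈ N ↔ u ∈ N)) :
    ENNReal.ofReal (T.domRestrict L).normDet *
        ∫⁻ u in N ∩ sphere 0 1, ENNReal.ofReal ((‖T u‖ ^ finrank ℝ L)⁻¹) ∂μHE[finrank ℝ L - 1] =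
      finrank ℝ L * μHE[finrank ℝ L] (T '' N ∩ ball 0 1) := by
  have : Nontrivial L := finrank_pos_iff.1 hL
  have hinj : Function.Injective (T.domRestrict L) :=
    ((T.domRestrict L).normDet_ne_zero_tfae.out 0 4).1 hT
  have hTc : Continuous T := T.continuous_of_finiteDimensional
  rw [setLIntegral_sphere_inter_submodule L _ hNL hN (by fun_prop),
    euclideanHausdorffMeasure_sphere_eq_toSphere]
  have h := setLIntegral_toSphere_inv_norm_pow (T.domRestrict L) hinj
    (measurable_subtype_coe hN : MeasurableSet ((↑) ⁻¹' N : Set L))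
    (fun u t ht => by simpa using hcone u t ht)
  simp only [LinearMap.domRestrict_apply] at h
  rw [h, mul_left_comm, ← LinearMap.euclideanHausdorffMeasure_image_eq_normDet_mul_volume]
  congr 2
  ext w
  constructor
  · rintro ⟨u, ⟨h1, h2⟩, rfl⟩
    exact ⟨⟨u, h1, rfl⟩, by simpa using h2⟩
  · rintro ⟨⟨u, h1, rfl⟩, h2⟩
    exact ⟨⟨u, hNL h1⟩, ⟨h1, by simpa using h2⟩, rfl⟩

end Polar

/-! ### Determinants of projections between subspaces and their complements. -/

section Projections

variable {V : Type*} [NormedAddCommGroup V] [InnerProductSpace ℝ V] [FiniteDimensional ℝ V]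

theorem inner_orthogonalProjectionOnto_add (E : Submodule ℝ V) (x y : V) :
    ⟪E.orthogonalProjectionOnto x, E.orthogonalProjectionOnto y⟫_ℝ +
      ⟪Eᗮ.orthogonalProjectionOnto x, Eᗮ.orthogonalProjectionOnto y⟫_ℝ = ⟪x, y⟫_ℝ := by
  rw [E.inner_orthogonalProjectionOnto_eq_of_mem_left,
    Eᗮ.inner_orthogonalProjectionOnto_eq_of_mem_left, ← inner_add_left]
  congr 1
  exact E.starProjection_add_starProjection_orthogonal x

theorem sum_inner_mul_inner_add {ι κ : Type*} [Fintype ι] [Fintype κ] {E : Submodule ℝ V}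
    (b : OrthonormalBasis ι ℝ E) (c : OrthonormalBasis κ ℝ Eᗮ) (x y : V) :
    ∑ j, ⟪x, b j⟫_ℝ * ⟪y, b j⟫_ℝ + ∑ j, ⟪x, c j⟫_ℝ * ⟪y, c j⟫_ℝ = ⟪x, y⟫_ℝ := by
  rw [← inner_orthogonalProjectionOnto_add E x y, ← b.sum_inner_mul_inner,
    ← c.sum_inner_mul_inner]
  congr 1 <;> refine Finset.sum_congr rfl fun j _ => ?_
  · rw [E.inner_orthogonalProjectionOnto_eq_of_mem_right,
      E.inner_orthogonalProjectionOnto_eq_of_mem_left, real_inner_comm y]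
  · rw [Eᗮ.inner_orthogonalProjectionOnto_eq_of_mem_right,
      Eᗮ.inner_orthogonalProjectionOnto_eq_of_mem_left, real_inner_comm y]

theorem toMatrix_orthogonalProjectionOnto {ι : Type*} [Fintype ι] [DecidableEq ι]
    (A B : Submodule ℝ V) (a : OrthonormalBasis ι ℝ A) (b : OrthonormalBasis ι ℝ B) :
    LinearMap.toMatrix a.toBasis b.toBasis (B.orthogonalProjectionOnto.toLinearMap ∘ₗ A.subtype) =
      Matrix.of fun i j => ⟪(b i : V), a j⟫_ℝ := by
  ext i j
  simp [LinearMap.toMatrix_apply, OrthonormalBasis.repr_apply_apply]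

theorem exists_orthonormalBasis_fin {m : ℕ} {A : Submodule ℝ V} (h : finrank ℝ A = m) :
    Nonempty (OrthonormalBasis (Fin m) ℝ A) := by
  subst h
  exact ⟨stdOrthonormalBasis ℝ A⟩

/-- In orthonormal bases the two matrices are transposes of each other. -/
theorem normDet_orthogonalProjectionOnto_comm {A B : Submodule ℝ V}
    (h : finrank ℝ A = finrank ℝ B) :
    (A.orthogonalProjectionOnto.toLinearMap ∘ₗ B.subtype).normDet =
      (B.orthogonalProjectionOnto.toLinearMap ∘ₗ A.subtype).normDet := by
  obtain ⟨a⟩ := exists_orthonormalBasis_fin h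
  obtain ⟨b⟩ := exists_orthonormalBasis_fin (rfl : finrank ℝ B = finrank ℝ B)
  rw [LinearMap.normDet_eq_norm_det_toMatrix _ a b, LinearMap.normDet_eq_norm_det_toMatrix _ b a,
    toMatrix_orthogonalProjectionOnto, toMatrix_orthogonalProjectionOnto, ← Matrix.det_transpose]
  congr 2
  ext i j
  simp [real_inner_comm]

theorem normDet_orthogonalProjectionOnto_orthogonal {A B : Submodule ℝ V}
    (h : finrank ℝ A = finrank ℝ B) :
    (Bᗮ.orthogonalProjectionOnto.toLinearMap ∘ₗ Aᗮ.subtype).normDet =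
      (B.orthogonalProjectionOnto.toLinearMap ∘ₗ A.subtype).normDet := by
  have h' : finrank ℝ Aᗮ = finrank ℝ Bᗮ := by
    have h1 := A.finrank_add_finrank_orthogonal
    have h2 := B.finrank_add_finrank_orthogonal
    omega
  obtain ⟨a⟩ := exists_orthonormalBasis_fin h
  obtain ⟨b⟩ := exists_orthonormalBasis_fin (rfl : finrank ℝ B = finrank ℝ B)
  obtain ⟨a'⟩ := exists_orthonormalBasis_fin h'
  obtain ⟨b'⟩ := exists_orthonormalBasis_fin (rfl : finrank ℝ Bᗮ = finrank ℝ Bᗮ)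
  rw [LinearMap.normDet_eq_norm_det_toMatrix _ a b, LinearMap.normDet_eq_norm_det_toMatrix _ a' b',
    toMatrix_orthogonalProjectionOnto, toMatrix_orthogonalProjectionOnto]
  set M₁ := Matrix.of fun i j => ⟪(b i : V), a j⟫_ℝ with hM₁
  set M₂ := Matrix.of fun i j => ⟪(b i : V), a' j⟫_ℝ with hM₂
  set M₃ := Matrix.of fun i j => ⟪(b' i : V), a j⟫_ℝ with hM₃
  set M₄ := Matrix.of fun i j => ⟪(b' i : V), a' j⟫_ℝ with hM₄
  have e₁ : M₁ * M₁.transpose + M₂ * M₂.transpose = 1 := by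
    ext i j
    simp only [Matrix.add_apply, Matrix.mul_apply, Matrix.transpose_apply, hM₁, hM₂,
      Matrix.of_apply, sum_inner_mul_inner_add a a']
    rw [Matrix.one_apply, ← Submodule.coe_inner, b.inner_eq_ite]
  have e₂ : M₁ * M₃.transpose + M₂ * M₄.transpose = 0 := by
    ext i j
    simp only [Matrix.add_apply, Matrix.mul_apply, Matrix.transpose_apply, hM₁, hM₂, hM₃, hM₄,
      Matrix.of_apply, sum_inner_mul_inner_add a a']
    exact (b' j).2 _ (b i).2
  have e₃ : M₃ * M₁.transpose + M₄ * M₂.transpose = 0 := by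
    have := congrArg Matrix.transpose e₂
    simpa [Matrix.transpose_add, Matrix.transpose_mul] using this
  have e₄ : M₃ * M₃.transpose + M₄ * M₄.transpose = 1 := by
    ext i j
    simp only [Matrix.add_apply, Matrix.mul_apply, Matrix.transpose_apply, hM₃, hM₄,
      Matrix.of_apply, sum_inner_mul_inner_add a a']
    rw [Matrix.one_apply, ← Submodule.coe_inner, b'.inner_eq_ite]
  have hU : Matrix.fromBlocks M₁ M₂ M₃ M₄ * (Matrix.fromBlocks M₁ M₂ M₃ M₄).transpose = 1 := by
    rw [Matrix.fromBlocks_transpose, Matrix.fromBlocks_multiply, e₁, e₂, e₃, e₄,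
      Matrix.fromBlocks_one]
  -- The full matrix is orthogonal; taking determinants here gives ±det M₄ = det M₁.
  have hD : Matrix.fromBlocks M₁ M₂ M₃ M₄ * Matrix.fromBlocks 1 M₃.transpose 0 M₄.transpose =
      Matrix.fromBlocks M₁ 0 M₃ 1 := by
    rw [Matrix.fromBlocks_multiply, e₂, e₄]
    simp
  have hU' := congrArg (fun M => ‖Matrix.det M‖) hU
  have hD' := congrArg (fun M => ‖Matrix.det M‖) hD
  simp only [Matrix.det_mul, Matrix.det_transpose, norm_mul, Matrix.det_one, norm_one,
    Matrix.det_fromBlocks_zero₂₁, Matrix.det_fromBlocks_zero₁₂, one_mul, mul_one] at hU' hD'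
  rw [← hD', (mul_self_eq_one_iff.1 hU').resolve_right (fun h => by
    linarith [norm_nonneg (Matrix.fromBlocks M₁ M₂ M₃ M₄).det]), one_mul]

end Projections

/-! ### Support faces, normal cones and linear programming duality. -/

section Faces

variable {d : ℕ} {P F G : Set (EuclideanSpace ℝ (Fin d))}

/-- The set of points of `P` that maximize the inner product with `u`. -/
def supportFace (P : Set (EuclideanSpace ℝ (Fin d))) (u : EuclideanSpace ℝ (Fin d)) :
    Set (EuclideanSpace ℝ (Fin d)) :=
  {x ∈ P | ∀ y ∈ P, ⟪u, y⟫_ℝ ≤ ⟪u, x⟫_ℝ}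

theorem isExposed_supportFace (P : Set (EuclideanSpace ℝ (Fin d)))
    (u : EuclideanSpace ℝ (Fin d)) : IsExposed ℝ P (supportFace P u) :=
  fun _ => ⟨innerSL ℝ u, rfl⟩

theorem mem_normalCone_supportFace (P : Set (EuclideanSpace ℝ (Fin d)))
    (u : EuclideanSpace ℝ (Fin d)) : u ∈ normalCone P (supportFace P u) := by
  intro x hx y hy
  rw [inner_sub_right]
  linarith [hx.2 y hy]

theorem subset_supportFace {u : EuclideanSpace ℝ (Fin d)} (hF : F ⊆ P) (hu : u ∈ normalCone P F) :
    F ⊆ supportFace P u := by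
  intro x hx
  refine ⟨hF hx, fun y hy => ?_⟩
  have := hu x hx y hy
  rw [inner_sub_right] at this
  linarith

theorem vectorSpan_le_ker_of_const {V : Type*} [AddCommGroup V] [Module ℝ V] {A : Set V}
    {l : V →ₗ[ℝ] ℝ} (h : ∀ x ∈ A, ∀ y ∈ A, l x = l y) : vectorSpan ℝ A ≤ l.ker := by
  rw [vectorSpan, Submodule.span_le]
  rintro _ ⟨x, hx, y, hy, rfl⟩
  simp [h x hx y hy]

theorem normalCone_subset_orthogonal (hF : F ⊆ P) :
    normalCone P F ⊆ ((vectorSpan ℝ F)ᗮ : Submodule ℝ (EuclideanSpace ℝ (Fin d))) := by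
  intro u hu
  have h : vectorSpan ℝ F ≤ (innerₛₗ ℝ u).ker := by
    refine vectorSpan_le_ker_of_const fun x hx y hy => ?_
    have h1 := hu x hx y (hF hy)
    have h2 := hu y hy x (hF hx)
    rw [inner_sub_right] at h1 h2
    simp only [innerₛₗ_apply_apply]
    linarith
  rw [SetLike.mem_coe, Submodule.mem_orthogonal']
  exact fun v hv => h hv

/-- A functional exposing F is constant on F, hence vanishes on its direction space, hence is
constant on G as well. -/
theorem subset_of_isExposed_of_vectorSpan_le (hF : IsExposed ℝ P F) (hne : F.Nonempty)
    (hFG : F ⊆ G) (hG : G ⊆ P) (h : vectorSpan ℝ G ≤ vectorSpan ℝ F) : G ⊆ F := by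
  obtain ⟨l, hl⟩ := hF hne
  obtain ⟨x, hx⟩ := hne
  have hmem : ∀ y, y ∈ F ↔ y ∈ P ∧ ∀ z ∈ P, l z ≤ l y := fun y => by rw [hl]; rfl
  have hker : vectorSpan ℝ F ≤ l.toLinearMap.ker :=
    vectorSpan_le_ker_of_const fun a ha b hb =>
      le_antisymm (((hmem b).1 hb).2 a ((hmem a).1 ha).1) (((hmem a).1 ha).2 b ((hmem b).1 hb).1)
  intro g hg
  have h1 : l (g -ᵥ x) = 0 := hker (h (vsub_mem_vectorSpan ℝ hg (hFG hx)))
  have h2 : l g = l x := by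
    rw [vsub_eq_sub, map_sub] at h1
    linarith
  exact (hmem g).2 ⟨hG hg, fun z hz => h2 ▸ ((hmem x).1 hx).2 z hz⟩

theorem subset_of_isExposed_of_finrank_le (hF : IsExposed ℝ P F) (hne : F.Nonempty)
    (hFG : F ⊆ G) (hG : G ⊆ P)
    (h : finrank ℝ (vectorSpan ℝ G) ≤ finrank ℝ (vectorSpan ℝ F)) : G ⊆ F :=
  subset_of_isExposed_of_vectorSpan_le hF hne hFG hG
    (Submodule.eq_of_le_of_finrank_le (vectorSpan_mono ℝ hFG) h).ge

theorem finite_exposed_faces (hP : IsConvexPolytope P) :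
    {F : Set (EuclideanSpace ℝ (Fin d)) | F.Nonempty ∧ IsExposed ℝ P F}.Finite := by
  refine ((Set.finite_le_nat d).biUnion fun k _ => kFaces_finite hP k).subset ?_
  rintro F ⟨hne, hF⟩
  have : finrank ℝ (vectorSpan ℝ F) ≤ d := by
    simpa using Submodule.finrank_le (vectorSpan ℝ F)
  exact mem_biUnion (x := finrank ℝ (vectorSpan ℝ F)) this ⟨hne, hF, rfl⟩

theorem IsConvexPolytope.isCompact (hP : IsConvexPolytope P) : IsCompact P := by
  obtain ⟨s, hs, -, rfl⟩ := hP
  exact hs.isCompact_convexHull ℝ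

theorem IsConvexPolytope.convex (hP : IsConvexPolytope P) : Convex ℝ P := by
  obtain ⟨s, hs, -, rfl⟩ := hP
  exact convex_convexHull ℝ s

theorem nonpos_of_forall_le_mul {a b : ℝ} (h : ∀ t ∈ Ioo (0 : ℝ) 1, a ≤ t * b) : a ≤ 0 := by
  have ht : Tendsto (fun t : ℝ => t * b) (𝓝[>] 0) (𝓝 (0 * b)) :=
    ((continuous_mul_const b).tendsto 0).mono_left nhdsWithin_le_nhds
  rw [zero_mul] at ht
  exact ge_of_tendsto ht (mem_of_superset (Ioo_mem_nhdsGT one_pos) h)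

/-- First-order optimality: compare p with p + t(y - p), divide by t and let t → 0. The new normal
is minus the gradient of the penalized objective. -/
theorem mem_supportFace_of_isMinOn (hP : Convex ℝ P)
    (E : Submodule ℝ (EuclideanSpace ℝ (Fin d))) {x z p : EuclideanSpace ℝ (Fin d)} (hx : x ∈ E)
    {r : ℝ} (hp : p ∈ P)
    (hmin : IsMinOn (fun q => r / 2 * ‖E.starProjection q - x‖ ^ 2 - ⟪z, q⟫_ℝ) P p) :
    p ∈ supportFace P (z + r • (x - E.starProjection p)) := by
  refine ⟨hp, fun y hy => sub_nonpos.1 ?_⟩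
  rw [← inner_sub_right]
  refine nonpos_of_forall_le_mul (b := r / 2 * ‖E.starProjection (y - p)‖ ^ 2) fun t ht => ?_
  have hq : p + t • (y - p) ∈ P := hP.add_smul_sub_mem hp hy ⟨ht.1.le, ht.2.le⟩
  have h := isMinOn_iff.1 hmin _ hq
  have e : E.starProjection (p + t • (y - p)) - x =
      (E.starProjection p - x) + t • E.starProjection (y - p) := by
    rw [map_add, map_smul]; abel
  have e' : ⟪E.starProjection p - x, E.starProjection (y - p)⟫_ℝ =
      - ⟪x - E.starProjection p, y - p⟫_ℝ := by
    rw [← inner_neg_left, neg_sub, ← Submodule.inner_starProjection_left_eq_right,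
      Submodule.starProjection_eq_self_iff.2 (E.sub_mem (E.starProjection_apply_mem p) hx)]
  rw [e, norm_add_sq_real, inner_smul_right, e', norm_smul, inner_add_right, inner_smul_right,
    mul_pow, Real.norm_eq_abs, sq_abs] at h
  rw [inner_add_left, inner_smul_left, conj_trivial]
  have ht0 := ht.1
  refine le_of_mul_le_mul_left ?_ ht0
  nlinarith

/-- Linear programming duality for the fibres of an orthogonal projection of a polytope. -/
theorem exists_mem_starProjection_image_supportFace (hP : IsConvexPolytope P)
    (E : Submodule ℝ (EuclideanSpace ℝ (Fin d))) {x z : EuclideanSpace ℝ (Fin d)}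
    (hx : x ∈ E.starProjection '' P) (hz : z ∈ Eᗮ) :
    ∃ u, Eᗮ.starProjection u = z ∧ x ∈ E.starProjection '' supportFace P u := by
  obtain ⟨q, hq, rfl⟩ := hx
  have hc := hP.isCompact
  have hxE : E.starProjection q ∈ E := E.starProjection_apply_mem q
  -- Maximize ⟪z, ·⟫ on the fibre through q by quadratic penalties of weight n. The minimizers yield
  -- normals u n with Eᗮ-component z.
  have hex : ∀ n : ℕ, ∃ p ∈ P, IsMinOn
      (fun y => (n : ℝ) / 2 * ‖E.starProjection y - E.starProjection q‖ ^ 2 - ⟪z, y⟫_ℝ) P p :=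
    fun n => hc.exists_isMinOn ⟨q, hq⟩ (by fun_prop)
  choose p hp hmin using hex
  let u : ℕ → EuclideanSpace ℝ (Fin d) := fun n =>
    z + (n : ℝ) • (E.starProjection q - E.starProjection (p n))
  have hpu : ∀ n, p n ∈ supportFace P (u n) := fun n =>
    mem_supportFace_of_isMinOn hP.convex E hxE (hp n) (hmin n)
  have huz : ∀ n, Eᗮ.starProjection (u n) = z := by
    intro n
    have h1 : E.starProjection q - E.starProjection (p n) ∈ Eᗮᗮ := by
      rw [Submodule.orthogonal_orthogonal]
      exact E.sub_mem hxE (E.starProjection_apply_mem _)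
    rw [map_add, map_smul, Submodule.starProjection_eq_self_iff.2 hz,
      (Submodule.starProjection_apply_eq_zero_iff Eᗮ).2 h1, smul_zero, add_zero]
  have : Finite {F : Set (EuclideanSpace ℝ (Fin d)) | F.Nonempty ∧ IsExposed ℝ P F} :=
    finite_exposed_faces hP
  -- Finitely many faces, so one face F serves infinitely many n. The u n may diverge, but a single
  -- one of them suffices, because the projected minimizers in F converge to the target point.
  obtain ⟨⟨F, hF⟩, hinf⟩ := Finite.exists_infinite_fiber
    (fun n : ℕ => (⟨supportFace P (u n), ⟨p n, hpu n⟩, isExposed_supportFace P (u n)⟩ :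
      {F : Set (EuclideanSpace ℝ (Fin d)) | F.Nonempty ∧ IsExposed ℝ P F}))
  have hinf' := Set.infinite_coe_iff.1 hinf
  have hmemF : ∀ n ∈ (fun n : ℕ => (⟨supportFace P (u n), ⟨p n, hpu n⟩,
      isExposed_supportFace P (u n)⟩ :
      {F : Set (EuclideanSpace ℝ (Fin d)) | F.Nonempty ∧ IsExposed ℝ P F})) ⁻¹' {⟨F, hF⟩},
      supportFace P (u n) = F := fun n hn => congrArg Subtype.val hn
  obtain ⟨R, hR⟩ := hc.isBounded.exists_norm_le
  have hbound : ∀ n : ℕ, (n : ℝ) * ‖E.starProjection (p n) - E.starProjection q‖ ^ 2 ≤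
      2 * (‖z‖ * (R + R)) := by
    intro n
    have h := isMinOn_iff.1 (hmin n) q hq
    rw [sub_self, norm_zero] at h
    have h1 : ⟪z, p n⟫_ℝ - ⟪z, q⟫_ℝ ≤ ‖z‖ * (R + R) := by
      rw [← inner_sub_right]
      refine (real_inner_le_norm _ _).trans (mul_le_mul_of_nonneg_left ?_ (norm_nonneg z))
      exact (norm_sub_le _ _).trans (add_le_add (hR _ (hp n)) (hR _ hq))
    linarith
  obtain ⟨n₀, hn₀⟩ := hinf'.nonempty
  refine ⟨u n₀, huz n₀, ?_⟩
  rw [hmemF n₀ hn₀]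
  have hclosed : IsClosed (E.starProjection '' F) :=
    ((hF.2.isCompact hc).image E.starProjection.continuous).isClosed
  rw [← hclosed.closure_eq, Metric.mem_closure_iff]
  intro ε hε
  obtain ⟨N, hN⟩ := exists_nat_gt (2 * (‖z‖ * (R + R)) / ε ^ 2)
  obtain ⟨n, hn, hNn⟩ := hinf'.exists_gt N
  refine ⟨_, ⟨p n, hmemF n hn ▸ hpu n, rfl⟩, ?_⟩
  rw [dist_comm, dist_eq_norm]
  refine lt_of_pow_lt_pow_left₀ 2 hε.le ?_
  have hNn' : (N : ℝ) < n := by exact_mod_cast hNn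
  rw [div_lt_iff₀ (by positivity)] at hN
  have h0 : (0 : ℝ) < n := lt_of_le_of_lt (Nat.cast_nonneg N) hNn'
  have h1 := hbound n
  have h2 : (N : ℝ) * ε ^ 2 ≤ n * ε ^ 2 := by gcongr
  exact lt_of_mul_lt_mul_left (by linarith) h0.le

end Faces

/-! ### Hausdorff measure under linear maps. -/

section HausdorffLinear

theorem exists_image_vadd_eq_of_vectorSpan_le {V : Type*} [NormedAddCommGroup V]
    [InnerProductSpace ℝ V] {L : Submodule ℝ V} {F : Set V}
    (h : vectorSpan ℝ F ≤ L) : ∃ (x : V) (s : Set L), F = x +ᵥ ((↑) '' s : Set V) := by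
  rcases F.eq_empty_or_nonempty with rfl | ⟨x, hx⟩
  · exact ⟨0, ∅, by simp⟩
  refine ⟨x, {v : L | x + v ∈ F}, ?_⟩
  ext y
  constructor
  · intro hy
    have hv : y - x ∈ L := h (vsub_mem_vectorSpan ℝ hy hx)
    exact ⟨y - x, ⟨⟨y - x, hv⟩, by simpa using hy, rfl⟩, by simp⟩
  · rintro ⟨_, ⟨v, hv, rfl⟩, rfl⟩
    exact hv

variable {V W : Type*} [NormedAddCommGroup V] [InnerProductSpace ℝ V]
  [MeasurableSpace V] [BorelSpace V] [NormedAddCommGroup W] [InnerProductSpace ℝ W]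
  [MeasurableSpace W] [BorelSpace W]

theorem euclideanHausdorffMeasure_image_of_vectorSpan_le {L : Submodule ℝ V}
    [FiniteDimensional ℝ L] {F : Set V} (h : vectorSpan ℝ F ≤ L) (T : V →ₗ[ℝ] W) :
    μHE[finrank ℝ L] (T '' F) =
      ENNReal.ofReal (T.domRestrict L).normDet * μHE[finrank ℝ L] F := by
  obtain ⟨x, s, rfl⟩ := exists_image_vadd_eq_of_vectorSpan_le h
  have h1 : T '' (x +ᵥ ((↑) '' s : Set V)) = T x +ᵥ (T.domRestrict L '' s) := by
    simp only [← image_vadd, image_image, vadd_eq_add, map_add, LinearMap.domRestrict_apply]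
  rw [h1, measure_vadd, measure_vadd, LinearMap.euclideanHausdorffMeasure_image,
    L.subtypeₗᵢ.isometry.euclideanHausdorffMeasure_image s |>.symm]
  rfl

theorem euclideanHausdorffMeasure_eq_zero_of_vectorSpan_le {L : Submodule ℝ V}
    [FiniteDimensional ℝ L] {F : Set V} (h : vectorSpan ℝ F ≤ L) {m : ℕ}
    (hm : finrank ℝ L < m) : μHE[m] F = 0 := by
  obtain ⟨x, s, rfl⟩ := exists_image_vadd_eq_of_vectorSpan_le h
  have h2 : μHE[m] ((↑) '' s : Set V) = μHE[m] s :=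
    L.subtypeₗᵢ.isometry.euclideanHausdorffMeasure_image s
  have h3 : (μH[(m : ℝ)] : Measure L) = 0 :=
    Real.hausdorffMeasure_of_finrank_lt (by exact_mod_cast hm)
  rw [measure_vadd, h2, Measure.euclideanHausdorffMeasure_def, h3]
  simp

theorem euclideanHausdorffMeasure_clm_image_eq_zero (T : V →L[ℝ] W) {m : ℕ} {A : Set V}
    (hA : μHE[m] A = 0) : μHE[m] (T '' A) = 0 := by
  have := (T.lipschitz.lipschitzOnWith (s := A)).euclideanHausdorffMeasure_image_le m
  rw [hA, mul_zero] at this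
  exact le_antisymm this zero_le

end HausdorffLinear

/-! ### Tiling the projection of P by projected k-faces. -/

section Tiling

variable {d k : ℕ} {P F G : Set (EuclideanSpace ℝ (Fin d))}
  {E : Submodule ℝ (EuclideanSpace ℝ (Fin d))}

theorem isClosed_normalCone (P F : Set (EuclideanSpace ℝ (Fin d))) :
    IsClosed (normalCone P F) := by
  have : normalCone P F = ⋂ x ∈ F, ⋂ y ∈ P, {u | ⟪u, y - x⟫_ℝ ≤ 0} := by
    ext u; simp [normalCone]
  rw [this]
  exact isClosed_biInter fun x _ => isClosed_biInter fun y _ =>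
    isClosed_le (by fun_prop) continuous_const

theorem smul_mem_normalCone_iff (P F : Set (EuclideanSpace ℝ (Fin d)))
    (u : EuclideanSpace ℝ (Fin d)) (t : ℝ) (ht : 0 < t) :
    t • u ∈ normalCone P F ↔ u ∈ normalCone P F := by
  simp only [normalCone, mem_ofPred_eq, inner_smul_left, conj_trivial]
  exact forall₂_congr fun x _ => forall₂_congr fun y _ =>
    ⟨fun h => nonpos_of_mul_nonpos_right h ht, fun h => mul_nonpos_of_nonneg_of_nonpos ht.le h⟩

/-- A closed set is σ-compact, so its image is a countable union of compact sets; the image itself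
need not be closed. -/
theorem measurableSet_image_of_isClosed {V W : Type*} [NormedAddCommGroup V] [NormedSpace ℝ V]
    [FiniteDimensional ℝ V] [NormedAddCommGroup W] [MeasurableSpace W] [BorelSpace W]
    {f : V → W} (hf : Continuous f) {s : Set V} (hs : IsClosed s) : MeasurableSet (f '' s) := by
  have := FiniteDimensional.proper_real V
  obtain ⟨K, hK, hKs⟩ := (isSigmaCompact_univ.of_isClosed_subset hs (subset_univ s)).image hf
  rw [← hKs]
  exact MeasurableSet.iUnion fun n => (hK n).isClosed.measurableSet

/-- The projections of the normal cones of faces of dimension above `k` form a null set. -/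
theorem euclideanHausdorffMeasure_iUnion_normalCone_eq_zero (hP : IsConvexPolytope P)
    (hkd : k ≤ d) (E : Submodule ℝ (EuclideanSpace ℝ (Fin d))) :
    μHE[d - k] (⋃ F ∈ {F | (F.Nonempty ∧ IsExposed ℝ P F) ∧ k < finrank ℝ (vectorSpan ℝ F)},
      Eᗮ.orthogonalProjectionOnto '' normalCone P F) = 0 := by
  rw [measure_biUnion_null_iff ((finite_exposed_faces hP).subset fun F h => h.1).countable]
  rintro F ⟨⟨-, hF⟩, hk⟩
  refine euclideanHausdorffMeasure_clm_image_eq_zero _ ?_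
  refine euclideanHausdorffMeasure_eq_zero_of_vectorSpan_le (L := (vectorSpan ℝ F)ᗮ) ?_ ?_
  · rw [vectorSpan, Submodule.span_le]
    rintro _ ⟨u, hu, v, hv, rfl⟩
    exact Submodule.sub_mem _ (normalCone_subset_orthogonal hF.subset hu)
      (normalCone_subset_orthogonal hF.subset hv)
  · have := (vectorSpan ℝ F).finrank_add_finrank_orthogonal
    rw [finrank_euclideanSpace_fin] at this
    omega

theorem euclideanHausdorffMeasure_image_eq_absDet_mul (hE : finrank ℝ E = k)
    (hF : finrank ℝ (vectorSpan ℝ F) = k) :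
    μHE[k] (E.orthogonalProjectionOnto '' F) =
      ENNReal.ofReal (absDet E (vectorSpan ℝ F)) * μHE[k] F := by
  have h := euclideanHausdorffMeasure_image_of_vectorSpan_le (le_refl (vectorSpan ℝ F))
    E.orthogonalProjectionOnto.toLinearMap
  rw [hF] at h
  rw [absDet, ← normDet_orthogonalProjectionOnto_comm (hE.trans hF.symm)]
  exact h

/-- A strictly larger support face would have dimension above k, placing z in the exceptional set.
-/
theorem eq_supportFace_of_notMem {u : EuclideanSpace ℝ (Fin d)} (hF : F ∈ kFaces P k)
    (hu : u ∈ normalCone P F) (hz : Eᗮ.orthogonalProjectionOnto u ∉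
      ⋃ F ∈ {F | (F.Nonempty ∧ IsExposed ℝ P F) ∧ k < finrank ℝ (vectorSpan ℝ F)},
        Eᗮ.orthogonalProjectionOnto '' normalCone P F) : supportFace P u = F := by
  obtain ⟨hne, hexp, hdim⟩ := hF
  have hsub := subset_supportFace hexp.subset hu
  refine Subset.antisymm (subset_of_isExposed_of_finrank_le hexp hne hsub (fun x hx => hx.1) ?_)
    hsub
  rw [hdim]
  by_contra! h
  exact hz (mem_biUnion (x := supportFace P u)
    ⟨⟨hne.mono hsub, isExposed_supportFace P u⟩, h⟩ ⟨u, mem_normalCone_supportFace P u, rfl⟩)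

theorem finrank_vectorSpan_inter_lt (hF : F ∈ kFaces P k) (hG : G ∈ kFaces P k)
    (hne : (F ∩ G).Nonempty) (hFG : F ≠ G) : finrank ℝ (vectorSpan ℝ (F ∩ G)) < k := by
  by_contra! h
  have hI : IsExposed ℝ P (F ∩ G) := hF.2.1.inter hG.2.1
  have h1 := subset_of_isExposed_of_finrank_le hI hne inter_subset_left hF.2.1.subset
    (hF.2.2.trans_le h)
  have h2 := subset_of_isExposed_of_finrank_le hI hne inter_subset_right hG.2.1.subset
    (hG.2.2.trans_le h)
  exact hFG (Subset.antisymm (h1.trans inter_subset_right) (h2.trans inter_subset_left))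

/-- Here u - v ∈ E and p - q ∈ Eᗮ, so u and v agree on p - q: as u prefers p to q, so does v, and p
also maximizes v. -/
theorem mem_inter_supportFace {u v p q : EuclideanSpace ℝ (Fin d)} (hp : p ∈ supportFace P u)
    (hq : q ∈ supportFace P v)
    (huv : Eᗮ.orthogonalProjectionOnto u = Eᗮ.orthogonalProjectionOnto v)
    (hpq : E.orthogonalProjectionOnto p = E.orthogonalProjectionOnto q) :
    p ∈ supportFace P u ∩ supportFace P v := by
  have h0 : ⟪u - v, p - q⟫_ℝ = 0 := by
    rw [← inner_orthogonalProjectionOnto_add E, map_sub, map_sub, map_sub, map_sub, huv, hpq]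
    simp
  refine ⟨hp, hp.1, fun y hy => (hq.2 y hy).trans ?_⟩
  have h1 := hp.2 q hq.1
  rw [inner_sub_left, inner_sub_right, inner_sub_right] at h0
  linarith [hq.2 p hp.1]

theorem aedisjoint_image_faces (hF : F ∈ kFaces P k)
    (hG : G ∈ kFaces P k) (hFG : F ≠ G) {z : Eᗮ}
    (hz : z ∉ ⋃ F ∈ {F | (F.Nonempty ∧ IsExposed ℝ P F) ∧ k < finrank ℝ (vectorSpan ℝ F)},
        Eᗮ.orthogonalProjectionOnto '' normalCone P F)
    (hzF : z ∈ Eᗮ.orthogonalProjectionOnto '' normalCone P F)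
    (hzG : z ∈ Eᗮ.orthogonalProjectionOnto '' normalCone P G) :
    AEDisjoint μHE[k] (E.orthogonalProjectionOnto '' F) (E.orthogonalProjectionOnto '' G) := by
  obtain ⟨u, hu, hu'⟩ := hzF
  obtain ⟨v, hv, hv'⟩ := hzG
  have hFu := eq_supportFace_of_notMem hF hu (hu' ▸ hz)
  have hGv := eq_supportFace_of_notMem hG hv (hv' ▸ hz)
  have hsub : E.orthogonalProjectionOnto '' F ∩ E.orthogonalProjectionOnto '' G ⊆
      E.orthogonalProjectionOnto '' (F ∩ G) := by
    rintro _ ⟨⟨p, hp, rfl⟩, ⟨q, hq, hpq⟩⟩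
    refine ⟨p, ?_, rfl⟩
    rw [← hFu] at hp ⊢
    rw [← hGv] at hq ⊢
    exact mem_inter_supportFace hp hq (hu'.trans hv'.symm) hpq.symm
  refine measure_mono_null hsub ?_
  rcases (F ∩ G).eq_empty_or_nonempty with h | h
  · simp [h]
  · exact euclideanHausdorffMeasure_clm_image_eq_zero _
      (euclideanHausdorffMeasure_eq_zero_of_vectorSpan_le le_rfl
        (finrank_vectorSpan_inter_lt hF hG h hFG))

open Classical in
/-- For generic `z`, the projections onto `E` of the `k`-faces whose normal cones meet the fibre
over `z` tile the projection of `P`. -/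
theorem euclideanHausdorffMeasure_image_eq_sum (hP : IsConvexPolytope P) (hE : finrank ℝ E = k)
    {z : Eᗮ}
    (hz : z ∉ ⋃ F ∈ {F | (F.Nonempty ∧ IsExposed ℝ P F) ∧ k < finrank ℝ (vectorSpan ℝ F)},
        Eᗮ.orthogonalProjectionOnto '' normalCone P F) :
    μHE[k] (E.orthogonalProjectionOnto '' P) =
      ∑ F ∈ (kFaces_finite hP k).toFinset with absDet E (vectorSpan ℝ F) ≠ 0,
        (Eᗮ.orthogonalProjectionOnto '' normalCone P F).indicator
          (fun _ => μHE[k] (E.orthogonalProjectionOnto '' F)) z := by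
  simp only [indicator_apply]
  rw [← Finset.sum_filter]
  set S := ((kFaces_finite hP k).toFinset.filter fun F => absDet E (vectorSpan ℝ F) ≠ 0).filter
    fun F => z ∈ Eᗮ.orthogonalProjectionOnto '' normalCone P F with hS
  have hmem : ∀ F, F ∈ S ↔ (F ∈ kFaces P k ∧ absDet E (vectorSpan ℝ F) ≠ 0) ∧
      z ∈ Eᗮ.orthogonalProjectionOnto '' normalCone P F := by
    intro F
    simp only [hS, Finset.mem_filter, Set.Finite.mem_toFinset]
  rw [← measure_biUnion_finset₀]
  · refine le_antisymm ?_ (measure_mono (iUnion₂_subset fun F hF =>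
      image_mono ((hmem F).1 hF).1.1.2.1.subset))
    -- Support faces with null projection are discarded into X; this covers dimension below k and
    -- k-faces with `absDet` zero.
    set X : Set E := ⋃ F ∈ {F | (F.Nonempty ∧ IsExposed ℝ P F) ∧
      μHE[k] (E.orthogonalProjectionOnto '' F) = 0}, E.orthogonalProjectionOnto '' F
    have hX : μHE[k] X = 0 := by
      rw [measure_biUnion_null_iff ((finite_exposed_faces hP).subset fun F h => h.1).countable]
      exact fun F hF => hF.2
    have hsub : E.orthogonalProjectionOnto '' P ⊆
        (⋃ F ∈ S, E.orthogonalProjectionOnto '' F) ∪ X := by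
      rintro _ ⟨q, hq, rfl⟩
      obtain ⟨u, hu, p, hp, hpq⟩ := exists_mem_starProjection_image_supportFace hP E
        (mem_image_of_mem _ hq) z.2
      have hu' : Eᗮ.orthogonalProjectionOnto u = z := Subtype.ext hu
      have hpq' : E.orthogonalProjectionOnto p = E.orthogonalProjectionOnto q := Subtype.ext hpq
      rw [← hpq']
      have hne : (supportFace P u).Nonempty := ⟨p, hp⟩
      have hle : finrank ℝ (vectorSpan ℝ (supportFace P u)) ≤ k := by
        by_contra! h
        exact hz (mem_biUnion (x := supportFace P u) ⟨⟨hne, isExposed_supportFace P u⟩, h⟩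
          ⟨u, mem_normalCone_supportFace P u, hu'⟩)
      by_cases h0 : μHE[k] (E.orthogonalProjectionOnto '' supportFace P u) = 0
      · exact Or.inr (mem_biUnion (x := supportFace P u)
          ⟨⟨hne, isExposed_supportFace P u⟩, h0⟩ ⟨p, hp, rfl⟩)
      · have hk : finrank ℝ (vectorSpan ℝ (supportFace P u)) = k := by
          refine hle.eq_of_not_lt fun h => h0 ?_
          exact euclideanHausdorffMeasure_clm_image_eq_zero _
            (euclideanHausdorffMeasure_eq_zero_of_vectorSpan_le le_rfl h)
        refine Or.inl (mem_biUnion (x := supportFace P u) ((hmem _).2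
          ⟨⟨⟨hne, isExposed_supportFace P u, hk⟩, fun h => h0 ?_⟩,
            ⟨u, mem_normalCone_supportFace P u, hu'⟩⟩) ⟨p, hp, rfl⟩)
        rw [euclideanHausdorffMeasure_image_eq_absDet_mul hE hk, h]
        simp
    calc _ ≤ _ := measure_mono hsub
      _ ≤ _ := measure_union_le _ _
      _ = _ := by rw [hX, add_zero]
  · intro F hF G hG hFG
    have hF' := (hmem F).1 hF
    have hG' := (hmem G).1 hG
    exact aedisjoint_image_faces hF'.1.1 hG'.1.1 hFG hz hF'.2 hG'.2
  · intro F hF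
    have hF' := (hmem F).1 hF
    exact ((hF'.1.1.2.1.isCompact hP.isCompact).image
      E.orthogonalProjectionOnto.continuous).isClosed.measurableSet.nullMeasurableSet

end Tiling

/-! ### Integrating the tiling identity over the unit ball of Eᗮ. -/

section Integration

variable {d k : ℕ} {P F : Set (EuclideanSpace ℝ (Fin d))}
  {E : Submodule ℝ (EuclideanSpace ℝ (Fin d))}

theorem finrank_orthogonal_of_finrank_eq (h : finrank ℝ E = k) : finrank ℝ Eᗮ = d - k := by
  have := E.finrank_add_finrank_orthogonal
  rw [finrank_euclideanSpace_fin] at this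
  omega

theorem absDet_mul_setLIntegral_unitNormals (hkd : k < d) (hE : finrank ℝ E = k)
    (hF : F ∈ kFaces P k) (h0 : absDet E (vectorSpan ℝ F) ≠ 0) :
    ENNReal.ofReal (absDet E (vectorSpan ℝ F)) *
        ∫⁻ u in unitNormals P F, ENNReal.ofReal (‖Eᗮ.starProjection u‖ ^ ((k : ℤ) - (d : ℤ)))
          ∂μHE[d - 1 - k] =
      (d - k : ℕ) * μHE[d - k] (Eᗮ.orthogonalProjectionOnto '' normalCone P F ∩ ball 0 1) := by
  have hfin := finrank_orthogonal_of_finrank_eq hF.2.2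
  have hdet : (Eᗮ.orthogonalProjectionOnto.toLinearMap.domRestrict (vectorSpan ℝ F)ᗮ).normDet =
      absDet E (vectorSpan ℝ F) :=
    (normDet_orthogonalProjectionOnto_orthogonal (hF.2.2.trans hE.symm)).trans
      (normDet_orthogonalProjectionOnto_comm (hE.trans hF.2.2.symm))
  have h := normDet_mul_setLIntegral_sphere (vectorSpan ℝ F)ᗮ (by omega)
    Eᗮ.orthogonalProjectionOnto.toLinearMap (hdet ▸ h0) (isClosed_normalCone P F).measurableSet
    (normalCone_subset_orthogonal hF.2.1.subset) (smul_mem_normalCone_iff P F)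
  rw [hdet, hfin] at h
  -- Rewrites d - 1 - k as (d - k) - 1, the dimension of the unit sphere in the complement of the
  -- direction space of F.
  rw [Nat.sub_right_comm]
  refine Eq.trans ?_ h
  have e : (k : ℤ) - d = -((d - k : ℕ) : ℤ) := by omega
  simp_rw [e, zpow_neg, zpow_natCast]
  rfl

theorem absDet_nonneg (A B : Submodule ℝ (EuclideanSpace ℝ (Fin d))) : 0 ≤ absDet A B :=
  LinearMap.normDet_nonneg _

theorem setLIntegral_unitNormals_lt_top (hkd : k < d) (hE : finrank ℝ E = k)
    (hF : F ∈ kFaces P k) (h0 : absDet E (vectorSpan ℝ F) ≠ 0) :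
    ∫⁻ u in unitNormals P F, ENNReal.ofReal (‖Eᗮ.starProjection u‖ ^ ((k : ℤ) - (d : ℤ)))
      ∂μHE[d - 1 - k] < ∞ := by
  have h := absDet_mul_setLIntegral_unitNormals hkd hE hF h0
  have hfin := finrank_orthogonal_of_finrank_eq hE
  have hlt : (d - k : ℕ) *
      μHE[d - k] (Eᗮ.orthogonalProjectionOnto '' normalCone P F ∩ ball 0 1) < ∞ := by
    refine ENNReal.mul_lt_top (ENNReal.natCast_lt_top _) ?_
    rw [← hfin, InnerProductSpace.euclideanHausdorffMeasure_eq_volume]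
    exact (measure_mono inter_subset_right).trans_lt measure_ball_lt_top
  rw [← h] at hlt
  refine lt_top_iff_ne_top.2 fun htop => ?_
  have hpos : 0 < absDet E (vectorSpan ℝ F) := lt_of_le_of_ne (absDet_nonneg _ _) h0.symm
  rw [htop, ENNReal.mul_top (by simpa using hpos)] at hlt
  exact lt_irrefl _ hlt

theorem measurable_norm_starProjection_zpow (E : Submodule ℝ (EuclideanSpace ℝ (Fin d)))
    (m : ℤ) : Measurable fun u => ‖E.starProjection u‖ ^ m :=
  (E.starProjection.continuous.norm.measurable).pow_const m

theorem integrableOn_unitNormals (hkd : k < d) (hE : finrank ℝ E = k)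
    (hF : F ∈ kFaces P k) (h0 : absDet E (vectorSpan ℝ F) ≠ 0) :
    IntegrableOn (fun u => ‖Eᗮ.starProjection u‖ ^ ((k : ℤ) - (d : ℤ)))
        (unitNormals P F) μHE[d - 1 - k] := by
  refine ⟨(measurable_norm_starProjection_zpow _ _).aestronglyMeasurable, ?_⟩
  rw [hasFiniteIntegral_iff_ofReal (Eventually.of_forall fun u => by positivity)]
  exact setLIntegral_unitNormals_lt_top hkd hE hF h0

theorem ofReal_sphereArea (hE : finrank ℝ E = k) (hkd : k < d) :
    ENNReal.ofReal (sphereArea (d - k)) = (d - k : ℕ) * μHE[d - k] (ball (0 : Eᗮ) 1) := by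
  have hfin := finrank_orthogonal_of_finrank_eq hE
  have : Nontrivial Eᗮ := finrank_pos_iff (R := ℝ).1 (by omega)
  have : Nontrivial (EuclideanSpace ℝ (Fin (d - k))) :=
    finrank_pos_iff (R := ℝ).1 (by rw [finrank_euclideanSpace_fin]; omega)
  have hv : volume (ball (0 : Eᗮ) 1) =
      volume (closedBall (0 : EuclideanSpace ℝ (Fin (d - k))) 1) := by
    rw [InnerProductSpace.volume_ball, InnerProductSpace.volume_closedBall, hfin,
      finrank_euclideanSpace_fin]
  have h2 : μHE[d - k] (ball (0 : Eᗮ) 1) = volume (ball (0 : Eᗮ) 1) := by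
    rw [← hfin, InnerProductSpace.euclideanHausdorffMeasure_eq_volume]
  rw [sphereArea, h2, hv, ENNReal.ofReal_mul (by positivity), ENNReal.ofReal_natCast,
    ENNReal.ofReal_toReal measure_closedBall_lt_top.ne]

open Classical in
-- One factor of `absDet` comes from projecting F to E, the other from projecting the normal cone to
-- Eᗮ.
theorem sphereArea_mul_measure_image_eq_sum (hP : IsConvexPolytope P) (hkd : k < d)
    (hE : finrank ℝ E = k) :
    ENNReal.ofReal (sphereArea (d - k)) * μHE[k] (E.orthogonalProjectionOnto '' P) =
      ∑ F ∈ (kFaces_finite hP k).toFinset with absDet E (vectorSpan ℝ F) ≠ 0,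
        ENNReal.ofReal (absDet E (vectorSpan ℝ F)) ^ 2 * μHE[k] F *
          ∫⁻ u in unitNormals P F, ENNReal.ofReal (‖Eᗮ.starProjection u‖ ^ ((k : ℤ) - (d : ℤ)))
            ∂μHE[d - 1 - k] := by
  have hmeas : ∀ F, MeasurableSet (Eᗮ.orthogonalProjectionOnto '' normalCone P F) := fun F =>
    measurableSet_image_of_isClosed Eᗮ.orthogonalProjectionOnto.continuous (isClosed_normalCone P F)
  have hae : ∀ᵐ z ∂(μHE[d - k] : Measure Eᗮ).restrict (ball 0 1),
      μHE[k] (E.orthogonalProjectionOnto '' P) =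
      ∑ F ∈ (kFaces_finite hP k).toFinset with absDet E (vectorSpan ℝ F) ≠ 0,
        (Eᗮ.orthogonalProjectionOnto '' normalCone P F).indicator
          (fun _ => μHE[k] (E.orthogonalProjectionOnto '' F)) z := by
    refine ae_restrict_of_ae ?_
    filter_upwards [measure_eq_zero_iff_ae_notMem.1
      (euclideanHausdorffMeasure_iUnion_normalCone_eq_zero hP hkd.le E)] with z hz
    exact euclideanHausdorffMeasure_image_eq_sum hP hE hz
  have hint := lintegral_congr_ae hae
  rw [setLIntegral_const, lintegral_finsetSum _ fun F _ => measurable_const.indicator (hmeas F)]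
    at hint
  rw [ofReal_sphereArea hE hkd, mul_assoc, mul_comm (μHE[d - k] _), hint, Finset.mul_sum]
  refine Finset.sum_congr rfl fun F hF => ?_
  rw [Finset.mem_filter, Set.Finite.mem_toFinset] at hF
  rw [lintegral_indicator_const (hmeas F), Measure.restrict_apply (hmeas F),
    euclideanHausdorffMeasure_image_eq_absDet_mul hE hF.1.2.2, mul_left_comm,
    ← absDet_mul_setLIntegral_unitNormals hkd hE hF.1 hF.2]
  ring

theorem projectionFunction_eq_toReal (k : ℕ) (P : Set (EuclideanSpace ℝ (Fin d)))
    (E : Submodule ℝ (EuclideanSpace ℝ (Fin d))) :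
    projectionFunction k P E = (μHE[k] (E.orthogonalProjectionOnto '' P)).toReal := by
  rw [projectionFunction, kVolume, ← E.subtypeₗᵢ.isometry.euclideanHausdorffMeasure_image,
    image_image]
  rfl

end Integration

end

theorem mainTheorem7 {d k : ℕ} (hk : 1 ≤ k) (hkd : k < d)
    {P : Set (EuclideanSpace ℝ (Fin d))} (hP : IsConvexPolytope P)
    (E : Submodule ℝ (EuclideanSpace ℝ (Fin d))) (hE : Module.finrank ℝ E = k) :
    (∀ F ∈ kFaces P k, absDet E (vectorSpan ℝ F) ≠ 0 →
      IntegrableOn (fun u => ‖Eᗮ.starProjection u‖ ^ ((k : ℤ) - (d : ℤ)))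
        (unitNormals P F) μHE[d - 1 - k]) ∧
    projectionFunction k P E =
      (sphereArea (d - k))⁻¹ *
        ∑ F ∈ (kFaces_finite hP k).toFinset with absDet E (vectorSpan ℝ F) ≠ 0,
          absDet E (vectorSpan ℝ F) ^ 2 * kVolume k F *
            ∫ u in unitNormals P F, ‖Eᗮ.starProjection u‖ ^ ((k : ℤ) - (d : ℤ)) ∂μHE[d - 1 - k] := by
  refine ⟨fun F hF h0 => integrableOn_unitNormals hkd hE hF h0, ?_⟩
  have hsum := sphereArea_mul_measure_image_eq_sum hP hkd hE
  have harea : 0 < sphereArea (d - k) := by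
    have h1 : (0 : ℝ) < (d - k : ℕ) := by exact_mod_cast Nat.sub_pos_of_lt hkd
    exact mul_pos h1 (ENNReal.toReal_pos
      (Metric.measure_closedBall_pos _ _ one_pos).ne' measure_closedBall_lt_top.ne)
  have hfin : μHE[k] (E.orthogonalProjectionOnto '' P) < ⊤ := by
    rw [← hE, InnerProductSpace.euclideanHausdorffMeasure_eq_volume]
    exact (hP.isCompact.image E.orthogonalProjectionOnto.continuous).measure_lt_top
  have hlt : ENNReal.ofReal (sphereArea (d - k)) *
      μHE[k] (E.orthogonalProjectionOnto '' P) < ⊤ := ENNReal.mul_lt_top ENNReal.ofReal_lt_top hfin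
  rw [projectionFunction_eq_toReal, eq_inv_mul_iff_mul_eq₀ harea.ne']
  have h := congrArg ENNReal.toReal hsum
  -- The total is finite, hence so is every summand, and `toReal` may be taken termwise.
  rw [hsum, ENNReal.sum_lt_top] at hlt
  rw [ENNReal.toReal_mul, ENNReal.toReal_ofReal harea.le,
    ENNReal.toReal_sum fun F hF => (hlt F (by convert hF)).ne] at h
  rw [h]
  refine Finset.sum_congr (by congr) fun F hF => ?_
  rw [ENNReal.toReal_mul, ENNReal.toReal_mul, ENNReal.toReal_pow,
    ENNReal.toReal_ofReal (absDet_nonneg _ _), kVolume,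
    integral_eq_lintegral_of_nonneg_ae (Filter.Eventually.of_forall fun u => by positivity)
      (measurable_norm_starProjection_zpow _ _).aestronglyMeasurable]
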